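/- Let $T>0$ and $d\in\mathbb N$, and let $\mathcal X$ be the set of continuous paths $x:[0,T]\to\mathbb R^{d}$ of bounded variation that have at least one strictly monotone coordinate. Fix any inner product $\langle\cdot,\cdot\rangle_1$ on $\mathbb R^d$, let $\langle\cdot,\cdot\rangle_k$ be the induced Hilbert–Schmidt inner product on $(\mathbb R^d)^{\otimes k}$ (that is, $\langle u_1\otimes\cdots\otimes u_k, v_1\otimes\cdots\otimes v_k\rangle_k=\prod_{l}\langle u_l,v_l\rangle_1$), and let $\mathcal T$ be the Hilbert space of sequences $a=(a_0,a_1,\dots)$, $a_k\in(\mathbb R^d)^{\otimes k}$, with $\sum_k\langle a_k,a_k\rangle_k<\infty$ and inner product $\langle a,b\rangle_{\mathcal T}=\sum_{k\ge 0}\langle a_k,b_k\rangle_k$. For $x\in\mathcal X$ let $S(x)=(1,S^1(x),S^2(x),\dots)$ be its signature, where $$S^k(x)=\int_{0<t_1<\dots<t_k<T}dx_{t_1}\otimes\cdots\otimes dx_{t_k}$$ are iterated Riemann–Stieltjes integrals, and let $k_{\mathrm{sig}}(x,y)=\langle S(x),S(y)\rangle_{\mathcal T}$ be the signature kernel. Endow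 $\mathcal X$ with any topology for which $S:\mathcal X\to\mathcal T$ is continuous, and with its Borel $\sigma$-algebra. For a Borel probability measure $\mathbb P$ on $\mathcal X$ and $y\in\mathcal X$ define the signature kernel score $$\phi_{\mathrm{sig}}(\mathbb P,y)=\mathbb E_{x,x'\sim\mathbb P}[k_{\mathrm{sig}}(x,x')]-2\,\mathbb E_{x\sim\mathbb P}[k_{\mathrm{sig}}(x,y)],$$ where $x,x'$ are independent. Let $\mathcal K\subset\mathcal X$ be compact, and suppose that paths which differ only by a translation and an increasing reparametrization are identified on $\mathcal K$: whenever $x,y\in\mathcal K$ satisfy $y=x\circ\varphi+c$ for some increasing bijection $\varphi$ of $[0,T]$ and some $c\in\mathbb R^d$, the points $x$ and $y$ are topologically indistinguishable (for a Hausdorff topology: $x=y$; this holds for instance if all paths in $\mathcal K$ have the same starting point and time $t\mapsto t$ as a common coordinate). Let $\mathcal P(\mathcal K)$ be the set of Borel probability measures on $\mathcal K$, regarded as measures on $\mathcal X$. Then the series defining $k_{\mathrm{sig}}$ converges, all expectations below and in the definition of $\phi_{\mathrm{sig}}$ are finite for measures in $\mathcal P(\mathcal K)$, and $\phi_{\mathrm{sig}}$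 is strictly proper relative to $\mathcal P(\mathcal K)$: for all $\mathbb P,\mathbb Q\in\mathcal P(\mathcal K)$, $$\mathbb E_{y\sim\mathbb Q}[\phi_{\mathrm{sig}}(\mathbb Q,y)]\le\mathbb E_{y\sim\mathbb Q}[\phi_{\mathrm{sig}}(\mathbb P,y)],$$ with equality if and only if $\mathbb P=\mathbb Q$. -/

import Mathlib

open MeasureTheory Filter Topology Set

noncomputable section

/-- The path space: continuous paths `[0,T] → ℝ^d` of bounded variation that have a (strictly)
monotone coordinate. The index of that coordinate, and whether it increases or decreases, may depend
on the path. (In finite dimension bounded variation does not depend on the norm.)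
No topology is put on this type here. -/
@[ext]
structure MonotonePath (T : ℝ) (d : ℕ) where
  /-- the underlying function -/
  toFun : Icc (0 : ℝ) T → Fin d → ℝ
  continuous_toFun : Continuous toFun
  boundedVariation : BoundedVariationOn toFun univ
  exists_monotone : ∃ i, StrictMono (fun t => toFun t i) ∨ StrictAnti (fun t => toFun t i)

namespace MonotonePath

variable {T : ℝ} {d : ℕ}

/-- Closed intervals in `[0,T]` are compact. -/
instance compactIccSpace : CompactIccSpace (Icc (0 : ℝ) T) :=
  ⟨fun {_ _} => isClosed_Icc.isCompact⟩

/-- Every coordinate of a path of bounded variation is of bounded variation. -/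
theorem boundedVariation_coord (x : MonotonePath T d) (i : Fin d) :
    BoundedVariationOn (fun t => x.toFun t i) univ :=
  ((LipschitzWith.eval (α := fun _ : Fin d => ℝ) i).lipschitzOnWith
    (s := univ)).comp_boundedVariationOn (mapsTo_univ _ _) x.boundedVariation

/-- The (signed) Stieltjes measure `dx^i` on `[0,T]` of the `i`-th coordinate of a path; for
continuous integrands, integration against it is the Riemann-Stieltjes integral. -/
def stieltjes (x : MonotonePath T d) (i : Fin d) : SignedMeasure (Icc (0 : ℝ) T) :=
  (x.boundedVariation_coord i).vectorMeasure

/-- The iterated Stieltjes integral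
`∫_{t₁ < ... < t_k, t_k ∈ A} dx^{i₁}_{t₁} ... dx^{i_k}_{t_k}` for the word `I = (i₁, ..., i_k)`. -/
def iteratedIntegral (x : MonotonePath T d) :
    (k : ℕ) → (Fin k → Fin d) → Set (Icc (0 : ℝ) T) → ℝ
  | 0, _, _ => 1
  | k + 1, I, A =>
    ∫ᵛ t in A, x.iteratedIntegral k (Fin.init I) (Iio t) ∂•(x.stieltjes (I (Fin.last k)))

/-- `x` and `y` are the same unparameterised path up to translation: `y = x ∘ φ + c` for an
increasing bijection `φ` of `[0,T]` and a vector `c`. -/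
def SameUnparam (x y : MonotonePath T d) : Prop :=
  ∃ (φ : Icc (0 : ℝ) T ≃o Icc (0 : ℝ) T) (c : Fin d → ℝ), ∀ t, y.toFun t = x.toFun (φ t) + c

end MonotonePath

/-- Formal tensor series over `ℝ^d`: the `k`-th entry is a tensor in `(ℝ^d)^{⊗k}`, given by its
coefficients in the basis `e_{i₁} ⊗ ... ⊗ e_{i_k}`. -/
abbrev TensorSeries (d : ℕ) : Type := (k : ℕ) → (Fin k → Fin d) → ℝ

/-- The Hilbert-Schmidt inner product on `(ℝ^d)^{⊗k}` induced by the inner product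
`⟨u, v⟩₁ = uᵀ G v` on `ℝ^d`, that is
`⟨u₁ ⊗ ... ⊗ u_k, v₁ ⊗ ... ⊗ v_k⟩_k = ⟨u₁, v₁⟩₁ ⋯ ⟨u_k, v_k⟩₁` extended bilinearly. -/
def levelInner {d : ℕ} (G : Matrix (Fin d) (Fin d) ℝ) (k : ℕ) (a b : (Fin k → Fin d) → ℝ) : ℝ :=
  ∑ I, ∑ J, a I * b J * ∏ l, G (I l) (J l)

/-- The inner product `⟨a, b⟩ = ∑_k ⟨a_k, b_k⟩_k` of (square-summable) tensor series, i.e. of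
elements of the Hilbert space completion of the tensor algebra. -/
def tensorInner {d : ℕ} (G : Matrix (Fin d) (Fin d) ℝ) (a b : TensorSeries d) : ℝ :=
  ∑' k, levelInner G k (a k) (b k)

/-- The signature `S(x) = (1, S¹(x), S²(x), ...)` of a path. -/
def signature {T : ℝ} {d : ℕ} (x : MonotonePath T d) : TensorSeries d :=
  fun k I => x.iteratedIntegral k I univ

/-- The signature kernel `k_sig(x, y) = ⟨S(x), S(y)⟩`. -/
def sigKernel {T : ℝ} {d : ℕ} (G : Matrix (Fin d) (Fin d) ℝ) (x y : MonotonePath T d) : ℝ :=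
  tensorInner G (signature x) (signature y)

/-- The signature is continuous for the given topology on path space: `‖S(y) - S(x)‖² → 0` as
`y → x`, in the Hilbert norm of the tensor series. -/
def SignatureContinuous {T : ℝ} {d : ℕ} (G : Matrix (Fin d) (Fin d) ℝ)
    [TopologicalSpace (MonotonePath T d)] : Prop :=
  ∀ x : MonotonePath T d,
    Tendsto (fun y => tensorInner G (signature y - signature x) (signature y - signature x))
      (𝓝 x) (𝓝 0)

/-- The signature kernel score
`φ_sig(P, y) = E_{x, x' ∼ P} k_sig(x, x') - 2 E_{x ∼ P} k_sig(x, y)`. -/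
def sigScore {T : ℝ} {d : ℕ} (G : Matrix (Fin d) (Fin d) ℝ) [MeasurableSpace (MonotonePath T d)]
    (P : Measure (MonotonePath T d)) (y : MonotonePath T d) : ℝ :=
  (∫ z, sigKernel G z.1 z.2 ∂(P.prod P)) - 2 * ∫ x, sigKernel G x y ∂P

/-- The probability measures on the subspace `K` of `X`, regarded as measures on `X` (by push-forward
along the inclusion). -/
def probabilityMeasuresOn {X : Type*} [MeasurableSpace X] (K : Set X) : Set (Measure X) :=
  {P | ∃ P' : Measure K, IsProbabilityMeasure P' ∧ P = P'.map Subtype.val}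

/-- A (negatively oriented) score `φ` is strictly proper relative to a class `C` of distributions:
`E_{y ∼ Q} φ(Q, y) ≤ E_{y ∼ Q} φ(P, y)` on `C`, with equality if and only if `P = Q`. -/
def IsStrictlyProper {X : Type*} [MeasurableSpace X] (φ : Measure X → X → ℝ)
    (C : Set (Measure X)) : Prop :=
  ∀ P ∈ C, ∀ Q ∈ C, (∫ y, φ Q y ∂Q) ≤ (∫ y, φ P y ∂Q) ∧
    ((∫ y, φ Q y ∂Q) = (∫ y, φ P y ∂Q) ↔ P = Q)

end

/-!
The signature kernel is the inner product of a feature map. Writing `G = Bᵀ B`, the tensor power of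
`B` turns the inner product given by `G` into the standard one, so the transformed signature is a map
`feature` into an `ℓ²` space with `k_sig(x, y) = ⟪feature x, feature y⟫`; it is well defined because
iterated integrals of length `k` are `O(C ^ k / k!)` (`abs_wordInt_le`), and continuous by assumption
on the topology. With `m_P` the mean of `feature` under `P`, the expected score of `P` under `Q` is
`‖m_P‖² - 2 ⟪m_P, m_Q⟫`, so the excess over the expected score of `Q` is `‖m_P - m_Q‖²`. It remains to
see that `m_P` determines `P` (`eq_of_integral_feature_eq`).

This is a Stone-Weierstrass argument (`ext_of_integral_family`) on `K` for the coefficients of the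
signature. Products of coefficients are sums of coefficients by the shuffle identity
(`wordInt_mul_wordInt`), which comes from Fubini's theorem on a square split along its diagonal. To
avoid signed measures, all the measures `dx^i` are given densities with respect to the sum of their
total variations, an atomless finite measure.

Coefficients separate points up to inseparability because equal signatures imply equality up to
translation and reparametrisation (`sameUnparam_of_signature_eq`). Indeed the signature contains the
moments `∫ (x^i_t - x^i_0)^k dx^j_t`, hence determines the image of `dx^j` under `x^i - x^i_0` for all
`i, j` (`stieltjes_preimage_eq`). If `x^i` and `y^i` are both strictly monotone in the same direction,
these images are the paths parametrised by the coordinate `i`. The monotone coordinates of `x` and `y`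
may a priori be different; that the one of `x` also serves `y` is `strictMono_of_signature_eq`.
-/

open scoped InnerProductSpace

namespace SignatureKernel

/-! ### Iterated integrals against an atomless measure -/

section Abstract

variable {X : Type*} [LinearOrder X] [MeasurableSpace X]

/-- The primitive `t ↦ ∫_{s < t} f s dρ(s)`. -/
noncomputable def primitive (ρ : Measure X) (f : X → ℝ) (t : X) : ℝ := ∫ s in Iio t, f s ∂ρ

theorem abs_primitive_le {ρ : Measure X} {f : X → ℝ} (hf : Integrable f ρ) (t : X) :
    |primitive ρ f t| ≤ ∫ s, |f s| ∂ρ :=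
  (abs_integral_le_integral_abs).trans
    (setIntegral_le_integral hf.abs (Eventually.of_forall fun _ => abs_nonneg _))

variable [TopologicalSpace X] [OrderTopology X] [SecondCountableTopology X] [BorelSpace X]
  {ρ : Measure X} [NullSingletonClass ρ]

theorem continuous_primitive {f : X → ℝ} (hf : Integrable f ρ) :
    Continuous (primitive ρ f) := by
  have h : primitive ρ f = fun t => ∫ s, (Iio t).indicator f s ∂ρ := by
    funext t
    rw [primitive, integral_indicator measurableSet_Iio]
  rw [h, continuous_iff_continuousAt]
  intro t
  refine continuousAt_of_dominated (bound := fun s => ‖f s‖) ?_ ?_ hf.norm ?_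
  · exact Eventually.of_forall fun t => hf.aestronglyMeasurable.indicator measurableSet_Iio
  · exact Eventually.of_forall fun t => Eventually.of_forall fun s => norm_indicator_le_norm_self _ _
  · have : ∀ᵐ s ∂ρ, s ≠ t := by simp [ae_iff, measure_singleton]
    filter_upwards [this] with s hs
    rcases lt_or_gt_of_ne hs with h | h
    · refine ContinuousAt.congr (f := fun _ => f s) continuousAt_const ?_
      filter_upwards [lt_mem_nhds h] with r hr
      exact (indicator_of_mem (mem_Iio.2 hr) f).symm
    · refine ContinuousAt.congr (f := fun _ => 0) continuousAt_const ?_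
      filter_upwards [gt_mem_nhds h] with r hr
      exact (indicator_of_notMem (by simpa using hr.le) f).symm

variable {α : Type*}

/-- Iterated integral of a word in the letters `α`, the letter `a` standing for the measure
`h a • ρ`. The head of the list is the outermost integration, i.e. the last letter of the word. -/
noncomputable def wordInt (ρ : Measure X) (h : α → X → ℝ) : List α → X → ℝ
  | [], _ => 1
  | a :: w, t => primitive ρ (fun s => wordInt ρ h w s * h a s) t

variable {h : α → X → ℝ}

theorem wordInt_regular (hh : ∀ a, Integrable (h a) ρ) (w : List α) :
    Continuous (wordInt ρ h w) ∧ (∃ C, ∀ t, |wordInt ρ h w t| ≤ C) := by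
  induction w with
  | nil => exact ⟨continuous_const, 1, fun t => by simp [wordInt]⟩
  | cons a w ih =>
    obtain ⟨hc, C, hC⟩ := ih
    have hi : Integrable (fun s => wordInt ρ h w s * h a s) ρ :=
      (hh a).bdd_mul hc.measurable.aestronglyMeasurable (Eventually.of_forall hC)
    exact ⟨continuous_primitive hi, _, abs_primitive_le hi⟩

theorem integrable_wordInt_mul (hh : ∀ a, Integrable (h a) ρ) (w : List α) (a : α) :
    Integrable (fun s => wordInt ρ h w s * h a s) ρ := by
  obtain ⟨hc, C, hC⟩ := wordInt_regular hh w
  exact (hh a).bdd_mul hc.measurable.aestronglyMeasurable (Eventually.of_forall hC)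

/-- The shuffles of two words, with multiplicity. -/
def shuffles : List α → List α → List (List α)
  | [], v => [v]
  | a :: w, [] => [a :: w]
  | a :: w, b :: v =>
    (shuffles w (b :: v)).map (a :: ·) ++ (shuffles (a :: w) v).map (b :: ·)
termination_by w v => w.length + v.length

theorem sum_wordInt_cons (hh : ∀ a, Integrable (h a) ρ) (a : α) (L : List (List α)) (t : X) :
    ((L.map (a :: ·)).map fun w => wordInt ρ h w t).sum =
      primitive ρ (fun s => (L.map fun w => wordInt ρ h w s).sum * h a s) t := by
  have : Integrable (fun s => (L.map fun w => wordInt ρ h w s).sum * h a s) ρ ∧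
    ((L.map (a :: ·)).map fun w => wordInt ρ h w t).sum =
      primitive ρ (fun s => (L.map fun w => wordInt ρ h w s).sum * h a s) t := by
    induction L with
    | nil => simp [primitive]
    | cons w L ih =>
      simp only [List.map_cons, List.sum_cons, add_mul]
      refine ⟨(integrable_wordInt_mul hh w a).add ih.1, ?_⟩
      rw [ih.2, wordInt, primitive, primitive, primitive,
        ← integral_add (integrable_wordInt_mul hh w a).restrict ih.1.restrict]
  exact this.2

variable [SFinite ρ]

/-- Integration by parts for atomless measures, from Fubini's theorem on the square
`s, r < t` split along its diagonal. -/
theorem primitive_mul_primitive {f g : X → ℝ} (hf : Integrable f ρ) (hg : Integrable g ρ) (t : X) :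
    primitive ρ f t * primitive ρ g t =
      primitive ρ (fun s => primitive ρ g s * f s) t +
      primitive ρ (fun s => primitive ρ f s * g s) t := by
  have hfg : Integrable (fun z : X × X => f z.1 * g z.2)
      ((ρ.restrict (Iio t)).prod (ρ.restrict (Iio t))) := hf.restrict.mul_prod hg.restrict
  set ρt := ρ.restrict (Iio t) with hρt
  have key : ∀ {f g : X → ℝ}, Integrable (fun z : X × X => f z.1 * g z.2) (ρt.prod ρt) →
      ∫ z in {z : X × X | z.2 < z.1}, f z.1 * g z.2 ∂(ρt.prod ρt) =
      primitive ρ (fun s => primitive ρ g s * f s) t := by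
    intro f g hfg
    have hm : MeasurableSet {z : X × X | z.2 < z.1} := measurableSet_lt measurable_snd measurable_fst
    rw [← integral_indicator hm, integral_prod _ (hfg.indicator hm), primitive]
    refine setIntegral_congr_fun measurableSet_Iio fun s hs => ?_
    have : ∀ r, {z : X × X | z.2 < z.1}.indicator (fun z => f z.1 * g z.2) (s, r)
        = (Iio s).indicator (fun r => f s * g r) r := fun r => by
      simp [indicator]
    simp only [this]
    rw [integral_indicator measurableSet_Iio, hρt, Measure.restrict_restrict measurableSet_Iio,
      Iio_inter_Iio, min_eq_left (le_of_lt hs), integral_const_mul, primitive, mul_comm]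
  have hm : MeasurableSet {z : X × X | z.2 < z.1} := measurableSet_lt measurable_snd measurable_fst
  have hm' : MeasurableSet {z : X × X | z.1 < z.2} := measurableSet_lt measurable_fst measurable_snd
  have hswap : ∫ z in {z : X × X | z.1 < z.2}, f z.1 * g z.2 ∂(ρt.prod ρt) =
      primitive ρ (fun s => primitive ρ f s * g s) t := by
    rw [← key (f := g) (g := f) (by simpa [mul_comm, Function.comp_def] using hfg.swap)]
    rw [← integral_indicator hm, ← integral_indicator hm', ← integral_prod_swap]
    refine integral_congr_ae (Eventually.of_forall fun z => ?_)
    simp [indicator, mul_comm]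
  have hdiag : (ρt.prod ρt) (diagonal X) = 0 := by
    rw [Measure.measure_prod_null measurableSet_diagonal]
    refine Eventually.of_forall fun s => ?_
    have : Prod.mk s ⁻¹' diagonal X = {s} := by ext r; simp [eq_comm]
    simp only [this, Pi.zero_apply]
    exact measure_singleton s
  have hcompl : ({z : X × X | z.2 < z.1}ᶜ : Set (X × X)) =ᵐ[ρt.prod ρt]
      {z : X × X | z.1 < z.2} := by
    have : ∀ᵐ z ∂(ρt.prod ρt), z ∉ diagonal X := measure_eq_zero_iff_ae_notMem.1 hdiag
    filter_upwards [this] with z hz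
    refine propext ⟨fun h => ?_, fun h => ?_⟩
    · exact lt_of_le_of_ne (not_lt.1 h) hz
    · exact not_lt.2 (le_of_lt h)
  rw [← key hfg, ← hswap, primitive, primitive, ← integral_prod_mul, ← integral_add_compl hm hfg,
    setIntegral_congr_set hcompl]

/-- The shuffle identity: the product of two iterated integrals is a sum of iterated integrals, the
words in it depending neither on the measure nor on the densities. -/
theorem wordInt_mul_wordInt (hh : ∀ a, Integrable (h a) ρ) (w v : List α) (t : X) :
    wordInt ρ h w t * wordInt ρ h v t = ((shuffles w v).map fun u => wordInt ρ h u t).sum := by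
  induction w, v using shuffles.induct generalizing t with
  | case1 v => simp [shuffles, wordInt]
  | case2 a w => simp [shuffles, wordInt]
  | case3 a w b v ih₁ ih₂ =>
    rw [shuffles, List.map_append, List.sum_append, sum_wordInt_cons hh, sum_wordInt_cons hh]
    simp only [← ih₁, ← ih₂]
    conv_lhs => rw [wordInt, wordInt, primitive_mul_primitive (integrable_wordInt_mul hh w a)
      (integrable_wordInt_mul hh v b)]
    congr 2
    · funext s
      rw [show wordInt ρ h (b :: v) s = primitive ρ (fun s => wordInt ρ h v s * h b s) s from rfl]
      ring
    · funext s
      rw [show wordInt ρ h (a :: w) s = primitive ρ (fun s => wordInt ρ h w s * h a s) s from rfl]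
      ring

/-- The iterated integral of a one-letter word is a divided power. -/
theorem wordInt_replicate (hh : ∀ a, Integrable (h a) ρ) (a : α) (k : ℕ) (t : X) :
    wordInt ρ h (List.replicate k a) t = primitive ρ (h a) t ^ k / k.factorial := by
  have h1 : ∀ t, wordInt ρ h [a] t = primitive ρ (h a) t := fun t => by simp [wordInt]
  have step : ∀ k t, wordInt ρ h [a] t * wordInt ρ h (List.replicate k a) t =
      (k + 1) * wordInt ρ h (List.replicate (k + 1) a) t := by
    intro k
    induction k with
    | zero => intro t; simp [wordInt]
    | succ k ih =>
      intro t
      have e : wordInt ρ h [a] t * wordInt ρ h (List.replicate (k + 1) a) t =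
        primitive ρ (h a) t * primitive ρ (fun s => wordInt ρ h (List.replicate k a) s * h a s) t := by
        rw [h1]; rfl
      rw [e, primitive_mul_primitive (hh a) (integrable_wordInt_mul hh _ a)]
      have e2 : (fun s => primitive ρ (h a) s * (wordInt ρ h (List.replicate k a) s * h a s)) =
        fun s => (k + 1) * (wordInt ρ h (List.replicate (k + 1) a) s * h a s) := by
        funext s
        rw [← h1, ← mul_assoc, ih]; ring
      have e3 : ∀ (c : ℝ) (f : X → ℝ), primitive ρ (fun s => c * f s) t = c * primitive ρ f t :=
        fun c f => integral_const_mul _ _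
      rw [e2, e3]
      have e4 : primitive ρ (fun s => wordInt ρ h (List.replicate (k + 1) a) s * h a s) t =
        wordInt ρ h (List.replicate (k + 2) a) t := rfl
      have e5 : primitive ρ (fun s => primitive ρ (fun s => wordInt ρ h (List.replicate k a) s *
        h a s) s * h a s) t = wordInt ρ h (List.replicate (k + 2) a) t := rfl
      rw [e4, e5]; push_cast; ring
  induction k with
  | zero => simp [wordInt]
  | succ k ih =>
    have hk := step k t
    rw [ih, h1] at hk
    have : ((k : ℝ) + 1) ≠ 0 := by positivity
    rw [Nat.factorial_succ, pow_succ]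
    push_cast
    field_simp at hk ⊢
    linarith

/-- Factorial decay: a word of length `k` is dominated by the `k`-fold iterated integral of a single
positive density. -/
theorem abs_wordInt_le [Fintype α] (hh : ∀ a, Integrable (h a) ρ) (w : List α) (t : X) :
    |wordInt ρ h w t| ≤ (∫ s, ∑ a, |h a s| ∂ρ) ^ w.length / w.length.factorial := by
  set H : Unit → X → ℝ := fun _ s => ∑ a, |h a s|
  have hH : ∀ u, Integrable (H u) ρ := fun _ => integrable_finsetSum _ fun a _ => (hh a).abs
  have hH0 : ∀ u s, 0 ≤ H u s := fun _ s => Finset.sum_nonneg fun a _ => abs_nonneg _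
  have h1 : |wordInt ρ h w t| ≤ wordInt ρ H (List.replicate w.length ()) t := by
    induction w generalizing t with
    | nil => simp [wordInt]
    | cons a w ih =>
      simp only [List.length_cons, List.replicate_succ, wordInt, primitive]
      refine abs_integral_le_integral_abs.trans (integral_mono
        (integrable_wordInt_mul hh w a).abs.restrict
        (integrable_wordInt_mul hH _ ()).restrict fun s => ?_)
      simp only [abs_mul]
      exact mul_le_mul (ih s) (Finset.single_le_sum (f := fun a => |h a s|)
        (fun a _ => abs_nonneg _) (Finset.mem_univ a)) (abs_nonneg _) ((abs_nonneg _).trans (ih s))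
  rw [wordInt_replicate hH] at h1
  refine h1.trans ?_
  have h2 : 0 ≤ primitive ρ (H ()) t := integral_nonneg (hH0 ())
  have h3 : primitive ρ (H ()) t ≤ ∫ s, ∑ a, |h a s| ∂ρ :=
    setIntegral_le_integral (hH ()) (Eventually.of_forall (hH0 ()))
  gcongr

end Abstract

/-! ### Signatures as iterated integrals against one positive measure -/

section Stieltjes

variable {T : ℝ} {d : ℕ} (x : MonotonePath T d)

theorem continuous_coord (i : Fin d) : Continuous fun t => x.toFun t i :=
  (continuous_apply i).comp x.continuous_toFun

theorem rightLim_coord (i : Fin d) (t : Icc (0 : ℝ) T) :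
    Function.rightLim (fun t => x.toFun t i) t = x.toFun t i :=
  (continuous_coord x i).continuousWithinAt.rightLim_eq

theorem leftLim_coord (i : Fin d) (t : Icc (0 : ℝ) T) :
    Function.leftLim (fun t => x.toFun t i) t = x.toFun t i :=
  (continuous_coord x i).continuousWithinAt.leftLim_eq

theorem stieltjes_Icc (i : Fin d) {s t : Icc (0 : ℝ) T} (h : s ≤ t) :
    x.stieltjes i (Icc s t) = x.toFun t i - x.toFun s i := by
  rw [MonotonePath.stieltjes, BoundedVariationOn.vectorMeasure_Icc _ h, rightLim_coord,
    leftLim_coord]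

theorem stieltjes_Ico (i : Fin d) {s t : Icc (0 : ℝ) T} (h : s ≤ t) :
    x.stieltjes i (Ico s t) = x.toFun t i - x.toFun s i := by
  rw [MonotonePath.stieltjes, BoundedVariationOn.vectorMeasure_Ico _ h, leftLim_coord,
    leftLim_coord]

theorem stieltjes_singleton (i : Fin d) (t : Icc (0 : ℝ) T) : x.stieltjes i {t} = 0 := by
  rw [← Icc_self, stieltjes_Icc x i le_rfl, sub_self]

/-- The sum of the total variation measures of the coordinates: a finite atomless measure which
dominates all of them. -/
noncomputable def refMeasure : Measure (Icc (0 : ℝ) T) :=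
  ∑ i, (x.stieltjes i).totalVariation

instance : IsFiniteMeasure (refMeasure x) := by
  unfold refMeasure
  infer_instance

theorem totalVariation_singleton (i : Fin d) (t : Icc (0 : ℝ) T) :
    (x.stieltjes i).totalVariation {t} = 0 := by
  rw [SignedMeasure.totalVariation_eq_variation,
    VectorMeasure.variation_apply_eq_zero (measurableSet_singleton t)]
  intro s hs _
  rcases subset_singleton_iff_eq.1 hs with rfl | rfl
  · simp
  · exact stieltjes_singleton x i t

instance : NullSingletonClass (refMeasure x) where
  measure_singleton t := by
    simp [refMeasure, totalVariation_singleton]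

theorem totalVariation_le_refMeasure (i : Fin d) :
    (x.stieltjes i).totalVariation ≤ refMeasure x := by
  unfold refMeasure
  exact Finset.single_le_sum (f := fun i => (x.stieltjes i).totalVariation)
    (fun _ _ => Measure.zero_le _) (Finset.mem_univ i)

theorem posPart_ac (i : Fin d) : (x.stieltjes i).toJordanDecomposition.posPart ≪ refMeasure x :=
  Measure.absolutelyContinuous_of_le
    ((Measure.le_add_right le_rfl).trans (totalVariation_le_refMeasure x i))

theorem negPart_ac (i : Fin d) : (x.stieltjes i).toJordanDecomposition.negPart ≪ refMeasure x :=
  Measure.absolutelyContinuous_of_le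
    ((Measure.le_add_left le_rfl).trans (totalVariation_le_refMeasure x i))

/-- The density of `dx^i` with respect to `refMeasure x`. -/
noncomputable def density (i : Fin d) (t : Icc (0 : ℝ) T) : ℝ :=
  ((x.stieltjes i).toJordanDecomposition.posPart.rnDeriv (refMeasure x) t).toReal -
    ((x.stieltjes i).toJordanDecomposition.negPart.rnDeriv (refMeasure x) t).toReal

theorem integrable_density (i : Fin d) : Integrable (density x i) (refMeasure x) :=
  Measure.integrable_toReal_rnDeriv.sub Measure.integrable_toReal_rnDeriv

end Stieltjes

section SignedIntegral

variable {Z : Type*} [MeasurableSpace Z]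

/-- Integration against a signed measure through its Jordan decomposition. -/
theorem vectorMeasure_integral_eq_sub (σ : SignedMeasure Z) {f : Z → ℝ} (hf : Measurable f)
    {C : ℝ} (hC : ∀ z, |f z| ≤ C) :
    ∫ᵛ z, f z ∂•σ = ∫ z, f z ∂σ.toJordanDecomposition.posPart -
      ∫ z, f z ∂σ.toJordanDecomposition.negPart := by
  have hi : ∀ (μ : Measure Z) [IsFiniteMeasure μ], μ.toSignedMeasure.Integrable f := by
    intro μ _
    rw [VectorMeasure.Integrable, Measure.variation_toSignedMeasure]
    exact Integrable.of_bound hf.aestronglyMeasurable C (Eventually.of_forall hC)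
  -- for real integrands the two scalar pairings coincide
  have hs : ContinuousLinearMap.lsmul ℝ ℝ = (ContinuousLinearMap.lsmul ℝ ℝ (E := ℝ)).flip := by
    ext; simp
  conv_lhs => rw [← σ.toSignedMeasure_toJordanDecomposition, JordanDecomposition.toSignedMeasure]
  rw [VectorMeasure.integral_sub_vectorMeasure (hi _) (hi _), hs,
    VectorMeasure.integral_toSignedMeasure, VectorMeasure.integral_toSignedMeasure]

end SignedIntegral

section Words

variable {T : ℝ} {d : ℕ} (x : MonotonePath T d)

theorem setIntegral_stieltjes (i : Fin d) {f : Icc (0 : ℝ) T → ℝ} (hf : Measurable f)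
    {C : ℝ} (hC : ∀ z, |f z| ≤ C) {A : Set (Icc (0 : ℝ) T)} (hA : MeasurableSet A) :
    ∫ᵛ t in A, f t ∂•(x.stieltjes i) = ∫ t in A, f t * density x i t ∂(refMeasure x) := by
  have hb : ∀ z, |A.indicator f z| ≤ C := fun z =>
    (norm_indicator_le_norm_self f z).trans (hC z)
  have hm : Measurable (A.indicator f) := hf.indicator hA
  have hint : ∀ (μ : Measure (Icc (0 : ℝ) T)) [IsFiniteMeasure μ],
      Integrable (fun t => (μ.rnDeriv (refMeasure x) t).toReal • A.indicator f t) (refMeasure x) :=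
    fun μ _ => Measure.integrable_toReal_rnDeriv.mul_bdd hm.aestronglyMeasurable
      (Eventually.of_forall hb)
  rw [← VectorMeasure.integral_indicator hA, vectorMeasure_integral_eq_sub _ hm hb,
    ← integral_rnDeriv_smul (posPart_ac x i), ← integral_rnDeriv_smul (negPart_ac x i),
    ← integral_sub (hint _) (hint _), ← integral_indicator hA]
  refine integral_congr_ae (Eventually.of_forall fun t => ?_)
  by_cases ht : t ∈ A
  · simp [ht, density]; ring
  · simp [ht]

/-- The word, last letter first, as a list. -/
def toWord {k : ℕ} (I : Fin k → Fin d) : List (Fin d) := (List.ofFn I).reverse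

theorem toWord_succ {k : ℕ} (I : Fin (k + 1) → Fin d) :
    toWord I = I (Fin.last k) :: toWord (Fin.init I) := by
  rw [toWord, List.ofFn_succ', List.concat_eq_append, List.reverse_append]
  rfl

/-- The iterated integrals with respect to signed measures are integrals of words against the single
positive measure `refMeasure x`. -/
theorem iteratedIntegral_succ {k : ℕ} (I : Fin (k + 1) → Fin d) {A : Set (Icc (0 : ℝ) T)}
    (hA : MeasurableSet A) :
    x.iteratedIntegral (k + 1) I A =
      ∫ t in A, wordInt (refMeasure x) (density x) (toWord (Fin.init I)) t *
        density x (I (Fin.last k)) t ∂(refMeasure x) := by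
  induction k generalizing A with
  | zero =>
    rw [MonotonePath.iteratedIntegral]
    exact setIntegral_stieltjes x _ (f := fun _ => 1) measurable_const (C := 1) (by simp) hA
  | succ k ih =>
    rw [MonotonePath.iteratedIntegral]
    have h : (fun t => x.iteratedIntegral (k + 1) (Fin.init I) (Iio t)) =
        wordInt (refMeasure x) (density x) (toWord (Fin.init I)) := by
      funext t
      rw [ih _ measurableSet_Iio, toWord_succ]
      rfl
    obtain ⟨hc, C, hC⟩ := wordInt_regular (integrable_density x) (toWord (Fin.init I))
    rw [h]
    exact setIntegral_stieltjes x _ hc.measurable hC hA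

/-- The coefficient of the signature at a word (last letter first). -/
noncomputable def coeff (w : List (Fin d)) (x : MonotonePath T d) : ℝ :=
  signature x w.length fun l => w.get l.rev

theorem toWord_get_rev (w : List (Fin d)) : toWord (fun l : Fin w.length => w.get l.rev) = w := by
  apply List.ext_getElem
  · simp [toWord]
  · intro n h1 h2
    simp [toWord, Fin.rev]
    congr 1
    omega

/-- Integrating over `[0,T]` instead of `[0,T)` makes no difference, as `refMeasure x` has no atoms.
-/
theorem signature_eq_wordInt (hT : 0 ≤ T) (k : ℕ) (I : Fin k → Fin d) :
    signature x k I = wordInt (refMeasure x) (density x) (toWord I) ⟨T, right_mem_Icc.2 hT⟩ := by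
  rw [signature]
  cases k with
  | zero => rfl
  | succ k =>
    rw [iteratedIntegral_succ x I MeasurableSet.univ, toWord_succ]
    refine setIntegral_congr_set ?_
    have h0 : ∀ᵐ t ∂(refMeasure x), t ≠ ⟨T, right_mem_Icc.2 hT⟩ := by
      rw [ae_iff]
      simp [measure_singleton]
    filter_upwards [h0] with t ht
    exact propext ⟨fun _ => lt_of_le_of_ne (Subtype.mk_le_mk.2 t.2.2) ht, fun _ => trivial⟩

theorem coeff_eq_wordInt (hT : 0 ≤ T) (w : List (Fin d)) :
    coeff w x = wordInt (refMeasure x) (density x) w ⟨T, right_mem_Icc.2 hT⟩ := by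
  rw [coeff, signature_eq_wordInt x hT, toWord_get_rev]

theorem signature_eq_coeff (hT : 0 ≤ T) (k : ℕ) (I : Fin k → Fin d) :
    signature x k I = coeff (toWord I) x := by
  rw [signature_eq_wordInt x hT, coeff_eq_wordInt x hT]

/-- The shuffle identity for signatures. -/
theorem coeff_mul_coeff (hT : 0 ≤ T) (w v : List (Fin d)) :
    coeff w x * coeff v x = ((shuffles w v).map fun u => coeff u x).sum := by
  simp only [coeff_eq_wordInt x hT]
  exact wordInt_mul_wordInt (integrable_density x) w v _

theorem abs_signature_le (hT : 0 ≤ T) (k : ℕ) (I : Fin k → Fin d) :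
    |signature x k I| ≤ (∫ s, ∑ i, |density x i s| ∂(refMeasure x)) ^ k / k.factorial := by
  have := abs_wordInt_le (integrable_density x) (toWord I) ⟨T, right_mem_Icc.2 hT⟩
  rw [signature_eq_wordInt x hT]
  simpa [toWord] using this

/-- The increment of a coordinate from the start of the path. -/
def incr (hT : 0 ≤ T) (x : MonotonePath T d) (i : Fin d) (t : Icc (0 : ℝ) T) : ℝ :=
  x.toFun t i - x.toFun ⟨0, left_mem_Icc.2 hT⟩ i

theorem continuous_incr (hT : 0 ≤ T) (i : Fin d) : Continuous (incr hT x i) :=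
  (continuous_coord x i).sub continuous_const

theorem primitive_density (hT : 0 ≤ T) (i : Fin d) (t : Icc (0 : ℝ) T) :
    primitive (refMeasure x) (density x i) t = incr hT x i t := by
  have h := setIntegral_stieltjes x i (f := fun _ => 1) measurable_const (C := 1) (by simp)
    (measurableSet_Iio (a := t))
  simp only [one_mul] at h
  have hfin : IsFiniteMeasure ((x.stieltjes i).variation.restrict (Iio t)) := by
    rw [← SignedMeasure.totalVariation_eq_variation]
    infer_instance
  have hle : ∀ s : Icc (0 : ℝ) T, ⟨0, left_mem_Icc.2 hT⟩ ≤ s := fun s => s.2.1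
  have h0 : Iio t = Ico ⟨0, left_mem_Icc.2 hT⟩ t := by
    ext s
    exact ⟨fun hs => ⟨hle s, hs⟩, fun hs => hs.2⟩
  rw [primitive, ← h, VectorMeasure.setIntegral_const, h0, stieltjes_Ico x i (hle t)]
  simp [incr]

/-- The moments of `dx^j` along the coordinate `i` are entries of the signature. -/
theorem integral_incr_pow (hT : 0 ≤ T) (i j : Fin d) (k : ℕ) :
    ∫ᵛ t, incr hT x i t ^ k ∂•(x.stieltjes j) =
      k.factorial * coeff (j :: List.replicate k i) x := by
  have hc : Continuous fun t => incr hT x i t ^ k := (continuous_incr x hT i).pow k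
  obtain ⟨C, hC⟩ := isCompact_univ.exists_bound_of_continuousOn hc.continuousOn
  have h1 := setIntegral_stieltjes x j hc.measurable (fun z => hC z trivial) MeasurableSet.univ
  have hw : toWord (Fin.snoc (fun _ : Fin k => i) j : Fin (k + 1) → Fin d) =
      j :: List.replicate k i := by
    rw [toWord_succ]
    simp [toWord]
  rw [VectorMeasure.restrict_univ] at h1
  rw [h1, ← hw, ← signature_eq_coeff x hT, signature, iteratedIntegral_succ x _ .univ,
    ← integral_const_mul]
  refine integral_congr_ae (Eventually.of_forall fun t => ?_)
  simp only [Fin.init_snoc, Fin.snoc_last]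
  have hw' : toWord (fun _ : Fin k => i) = List.replicate k i := by simp [toWord]
  rw [hw', wordInt_replicate (integrable_density x), primitive_density x hT]
  field_simp

end Words

/-! ### Determination of measures by algebras of functions and by moments -/

section Determination

/-- Finite measures on a compact metrizable space are determined by the integrals of a
point-separating algebra of continuous functions (Stone-Weierstrass). -/
theorem ext_of_integral_subalgebra {C : Type*} [TopologicalSpace C] [CompactSpace C]
    [TopologicalSpace.MetrizableSpace C] [MeasurableSpace C] [BorelSpace C]
    (A : Subalgebra ℝ C(C, ℝ)) (hA : A.SeparatesPoints) {μ ν : Measure C} [IsFiniteMeasure μ]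
    [IsFiniteMeasure ν] (h : ∀ f ∈ A, ∫ z, f z ∂μ = ∫ z, f z ∂ν) : μ = ν := by
  let := TopologicalSpace.metrizableSpaceMetric C
  have hcont : ∀ (m : Measure C) [IsFiniteMeasure m], Continuous fun f : C(C, ℝ) => ∫ z, f z ∂m := by
    intro m _
    have hint : ∀ f : C(C, ℝ), Integrable (fun z => f z) m := fun f =>
      Integrable.of_bound f.continuous.aestronglyMeasurable ‖f‖
        (Eventually.of_forall f.norm_coe_le_norm)
    refine (LipschitzWith.of_dist_le_mul (K := (m.real univ).toNNReal)
      fun f g => ?_).continuous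
    rw [dist_eq_norm, ← integral_sub (hint f) (hint g), dist_eq_norm,
      Real.coe_toNNReal _ measureReal_nonneg, mul_comm]
    exact norm_integral_le_of_norm_le_const (Eventually.of_forall fun z => (f - g).norm_coe_le_norm z)
  have hclosed : IsClosed {f : C(C, ℝ) | ∫ z, f z ∂μ = ∫ z, f z ∂ν} :=
    isClosed_eq (hcont μ) (hcont ν)
  refine ext_of_forall_integral_eq_of_IsFiniteMeasure fun f => ?_
  have hmem : f.toContinuousMap ∈ A.topologicalClosure := by
    rw [ContinuousMap.subalgebra_topologicalClosure_eq_top_of_separatesPoints A hA]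
    trivial
  exact closure_minimal (show (A : Set C(C, ℝ)) ⊆ _ from h) hclosed hmem

/-- Finite Borel measures on a compact, not necessarily Hausdorff, space are determined by the
integrals of countably many continuous functions whose span is closed under multiplication and
which separate topologically distinguishable points. -/
theorem ext_of_integral_family {Z ι : Type*} [TopologicalSpace Z] [CompactSpace Z]
    [MeasurableSpace Z] [BorelSpace Z] [Countable ι] (s : ι → Z → ℝ) (hs : ∀ i, Continuous (s i))
    (hsep : ∀ z z', (∀ i, s i z = s i z') → Inseparable z z')
    (hone : ∃ e, ∀ z, s e z = 1)
    (hmul : ∀ i j, ∃ L : List ι, ∀ z, s i z * s j z = (L.map fun l => s l z).sum)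
    {P Q : Measure Z} [IsFiniteMeasure P] [IsFiniteMeasure Q]
    (h : ∀ i, ∫ z, s i z ∂P = ∫ z, s i z ∂Q) : P = Q := by
  have hΨ : Continuous fun z i => s i z := continuous_pi hs
  set Ψ : Z → (ι → ℝ) := fun z i => s i z with hΨdef
  let φ : Z → range Ψ := rangeFactorization Ψ
  have hφ : Continuous φ := hΨ.subtype_mk _
  have hφs : Function.Surjective φ := rangeFactorization_surjective
  have hC : CompactSpace (range Ψ) := isCompact_iff_compactSpace.1 (isCompact_range hΨ)
  let c : ι → C(range Ψ, ℝ) := fun i =>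
    ⟨fun p => p.1 i, (continuous_apply i).comp continuous_subtype_val⟩
  have hcφ : ∀ i z, c i (φ z) = s i z := fun i z => rfl
  let V : Submodule ℝ C(range Ψ, ℝ) := Submodule.span ℝ (range c)
  have hVone : 1 ∈ V := by
    obtain ⟨e, he⟩ := hone
    refine Submodule.subset_span ⟨e, ?_⟩
    ext p
    obtain ⟨z, rfl⟩ := hφs p
    simp [hcφ, he]
  have hVmul : ∀ f g, f ∈ V → g ∈ V → f * g ∈ V := by
    intro f g hf hg
    induction hf, hg using Submodule.span_induction₂ with
    | mem_mem f g hf hg =>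
      obtain ⟨i, rfl⟩ := hf
      obtain ⟨j, rfl⟩ := hg
      obtain ⟨L, hL⟩ := hmul i j
      have : c i * c j = (L.map c).sum := by
        ext p
        obtain ⟨z, rfl⟩ := hφs p
        have hev : ∀ L : List ι, (L.map c).sum (φ z) = (L.map fun l => s l z).sum := by
          intro L
          induction L with
          | nil => rfl
          | cons l L ih => simp [ih, hcφ]
        rw [hev, ContinuousMap.mul_apply, hcφ, hcφ, hL]
      rw [this]
      refine V.list_sum_mem fun f hf => ?_
      obtain ⟨l, -, rfl⟩ := List.mem_map.1 hf
      exact Submodule.subset_span ⟨l, rfl⟩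
    | zero_left => simp
    | zero_right => simp
    | add_left f f' g _ _ _ h1 h2 => rw [add_mul]; exact V.add_mem h1 h2
    | add_right f g g' _ _ _ h1 h2 => rw [mul_add]; exact V.add_mem h1 h2
    | smul_left r f g _ _ h1 => rw [smul_mul_assoc]; exact V.smul_mem r h1
    | smul_right r f g _ _ h1 => rw [mul_smul_comm]; exact V.smul_mem r h1
  have hsepV : (V.toSubalgebra hVone hVmul).SeparatesPoints := by
    intro p q hpq
    obtain ⟨i, hi⟩ := Function.ne_iff.1 (Subtype.coe_ne_coe.2 hpq)
    exact ⟨_, ⟨c i, Submodule.subset_span ⟨i, rfl⟩, rfl⟩, hi⟩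
  have hint : ∀ (μ : Measure (range Ψ)) [IsFiniteMeasure μ] (f : C(range Ψ, ℝ)),
      Integrable (fun z => f z) μ := fun μ _ f =>
    Integrable.of_bound f.continuous.aestronglyMeasurable ‖f‖
      (Eventually.of_forall f.norm_coe_le_norm)
  have hmap : P.map φ = Q.map φ := by
    refine ext_of_integral_subalgebra _ hsepV fun f hf => ?_
    change f ∈ V at hf
    induction hf using Submodule.span_induction with
    | mem f hf =>
      obtain ⟨i, rfl⟩ := hf
      rw [integral_map hφ.measurable.aemeasurable (c i).continuous.aestronglyMeasurable,
        integral_map hφ.measurable.aemeasurable (c i).continuous.aestronglyMeasurable]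
      exact h i
    | zero => simp
    | add f g _ _ h1 h2 =>
      simp only [ContinuousMap.add_apply]
      rw [integral_add (hint _ f) (hint _ g), integral_add (hint _ f) (hint _ g), h1, h2]
    | smul r f _ h1 =>
      simp only [ContinuousMap.smul_apply]
      rw [integral_smul, integral_smul, h1]
  -- closed sets are saturated for `φ`, so the image measures determine `P` and `Q` on them
  have hclosed : ∀ F : Set Z, IsClosed F → MeasurableSet (φ '' F) ∧ φ ⁻¹' (φ '' F) = F := by
    intro F hF
    refine ⟨(hF.isCompact.image hφ).isClosed.measurableSet, ?_⟩
    refine Subset.antisymm ?_ (subset_preimage_image φ F)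
    rintro z ⟨z', hz', hzz⟩
    have : Inseparable z' z := hsep _ _ fun i => congrFun (congrArg Subtype.val hzz) i
    exact (this.mem_closed_iff hF).1 hz'
  have hval : ∀ F : Set Z, IsClosed F → P F = Q F := by
    intro F hF
    obtain ⟨hm, he⟩ := hclosed F hF
    rw [← he, ← Measure.map_apply hφ.measurable hm, hmap, Measure.map_apply hφ.measurable hm]
  exact ext_of_generate_finite {F | IsClosed F}
    (BorelSpace.measurable_eq.trans borel_eq_generateFrom_isClosed) isPiSystem_isClosed
    (fun F hF => hval F hF) (hval _ isClosed_univ)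

/-- Two signed measures `σ, τ` on compact spaces with the same moments along continuous functions
`u, v` have the same image measure under `u` and `v`. -/
theorem signedMeasure_preimage_eq_of_moments {Z : Type*} [TopologicalSpace Z] [CompactSpace Z]
    [MeasurableSpace Z] [BorelSpace Z] {σ τ : SignedMeasure Z} {u v : Z → ℝ}
    (hu : Continuous u) (hv : Continuous v)
    (h : ∀ k : ℕ, ∫ᵛ z, u z ^ k ∂•σ = ∫ᵛ z, v z ^ k ∂•τ) {A : Set ℝ} (hA : MeasurableSet A) :
    σ (u ⁻¹' A) = τ (v ⁻¹' A) := by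
  obtain ⟨R, hR⟩ : ∃ R, ∀ z, |u z| ≤ R ∧ |v z| ≤ R := by
    obtain ⟨C, hC⟩ := isCompact_univ.exists_bound_of_continuousOn hu.continuousOn
    obtain ⟨D, hD⟩ := isCompact_univ.exists_bound_of_continuousOn hv.continuousOn
    exact ⟨max C D, fun z => ⟨(hC z trivial).trans (le_max_left _ _),
      (hD z trivial).trans (le_max_right _ _)⟩⟩
  let u' : Z → Icc (-R) R := fun z => ⟨u z, abs_le.1 (hR z).1⟩
  let v' : Z → Icc (-R) R := fun z => ⟨v z, abs_le.1 (hR z).2⟩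
  have hu' : Continuous u' := hu.subtype_mk _
  have hv' : Continuous v' := hv.subtype_mk _
  set p := σ.toJordanDecomposition.posPart
  set n := σ.toJordanDecomposition.negPart
  set p' := τ.toJordanDecomposition.posPart
  set n' := τ.toJordanDecomposition.negPart
  have hint : ∀ (μ : Measure (Icc (-R) R)) [IsFiniteMeasure μ] {f : Icc (-R) R → ℝ},
      Continuous f → Integrable f μ := by
    intro μ _ f hf
    obtain ⟨C, hC⟩ := isCompact_univ.exists_bound_of_continuousOn hf.continuousOn
    exact Integrable.of_bound hf.aestronglyMeasurable C (Eventually.of_forall fun z => hC z trivial)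
  have hpow : ∀ k : ℕ, Continuous fun z : Icc (-R) R => (z : ℝ) ^ k := fun k => by fun_prop
  have hmom : ∀ k : ℕ, ∫ z, (z : ℝ) ^ k ∂(p.map u' + n'.map v') =
      ∫ z, (z : ℝ) ^ k ∂(n.map u' + p'.map v') := by
    intro k
    have hb : ∀ w : Z → ℝ, (∀ z, |w z| ≤ R) → ∀ z, |w z ^ k| ≤ R ^ k := fun w hw z => by
      rw [abs_pow]
      exact pow_le_pow_left₀ (abs_nonneg _) (hw z) k
    have hk := h k
    rw [vectorMeasure_integral_eq_sub σ (hu.measurable.pow_const k) (hb u fun z => (hR z).1),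
      vectorMeasure_integral_eq_sub τ (hv.measurable.pow_const k) (hb v fun z => (hR z).2)] at hk
    rw [integral_add_measure (hint _ (hpow k)) (hint _ (hpow k)),
      integral_add_measure (hint _ (hpow k)) (hint _ (hpow k)),
      integral_map hu'.measurable.aemeasurable (hpow k).aestronglyMeasurable,
      integral_map hu'.measurable.aemeasurable (hpow k).aestronglyMeasurable,
      integral_map hv'.measurable.aemeasurable (hpow k).aestronglyMeasurable,
      integral_map hv'.measurable.aemeasurable (hpow k).aestronglyMeasurable]
    simp only [u', v'] at hk ⊢
    linarith
  -- negative parts are moved to the other side so as to compare positive measures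
  have hmeas : p.map u' + n'.map v' = n.map u' + p'.map v' := by
    refine ext_of_integral_family (fun (k : ℕ) (z : Icc (-R) R) => (z : ℝ) ^ k) hpow
      (fun z z' hz => ?_) ⟨0, fun z => pow_zero _⟩
      (fun i j => ⟨[i + j], fun z => by simp [pow_add]⟩) hmom
    have := hz 1
    simp only [pow_one] at this
    exact Inseparable.of_eq (Subtype.ext this)
  have hA' : MeasurableSet (Subtype.val ⁻¹' A : Set (Icc (-R) R)) := measurable_subtype_coe hA
  have hval : (p.map u' + n'.map v').real (Subtype.val ⁻¹' A) =
      (n.map u' + p'.map v').real (Subtype.val ⁻¹' A) := by rw [hmeas]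
  rw [measureReal_add_apply, measureReal_add_apply, map_measureReal_apply hu'.measurable hA',
    map_measureReal_apply hu'.measurable hA', map_measureReal_apply hv'.measurable hA',
    map_measureReal_apply hv'.measurable hA'] at hval
  have e1 : u' ⁻¹' (Subtype.val ⁻¹' A) = u ⁻¹' A := rfl
  have e2 : v' ⁻¹' (Subtype.val ⁻¹' A) = v ⁻¹' A := rfl
  rw [e1, e2] at hval
  have hσ := σ.apply_eq_posPart_real_sub_negPart_real (hu.measurable hA)
  have hτ := τ.apply_eq_posPart_real_sub_negPart_real (hv.measurable hA)
  rw [hσ, hτ]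
  linarith

end Determination

/-! ### Uniqueness of signatures of paths with a monotone coordinate -/

section Injectivity

variable {T : ℝ} {d : ℕ} {x y : MonotonePath T d}

theorem Iic_eq_Icc_left (hT : 0 ≤ T) (t : Icc (0 : ℝ) T) : Iic t = Icc ⟨0, left_mem_Icc.2 hT⟩ t := by
  ext s
  exact ⟨fun h => ⟨s.2.1, h⟩, fun h => h.2⟩

theorem univ_eq_Icc (hT : 0 ≤ T) :
    (univ : Set (Icc (0 : ℝ) T)) = Icc ⟨0, left_mem_Icc.2 hT⟩ ⟨T, right_mem_Icc.2 hT⟩ := by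
  ext s
  exact ⟨fun _ => ⟨s.2.1, s.2.2⟩, fun _ => trivial⟩

/-- If `a x^i` is increasing, then `a dx^i` is a positive measure. -/
theorem mul_stieltjes_nonneg (hT : 0 ≤ T) {a : ℝ} {i : Fin d}
    (hx : Monotone fun t => a * x.toFun t i) (B : Set (Icc (0 : ℝ) T)) :
    0 ≤ a * x.stieltjes i B := by
  have hc : Continuous fun t => a * x.toFun t i := continuous_const.mul (continuous_coord x i)
  let F : StieltjesFunction (Icc (0 : ℝ) T) :=
    ⟨fun t => a * x.toFun t i, hx, fun t => hc.continuousWithinAt⟩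
  set o : Icc (0 : ℝ) T := ⟨0, left_mem_Icc.2 hT⟩
  set e : Icc (0 : ℝ) T := ⟨T, right_mem_Icc.2 hT⟩
  have ho : ∀ s : Icc (0 : ℝ) T, o ≤ s := fun s => s.2.1
  have hIic : ∀ t, Iic t = Icc o t := Iic_eq_Icc_left hT
  have huniv : (univ : Set (Icc (0 : ℝ) T)) = Icc o e := univ_eq_Icc hT
  have hFm : ∀ t, F.measure (Icc o t) = ENNReal.ofReal (a * x.toFun t i - a * x.toFun o i) := by
    intro t
    rw [StieltjesFunction.measure_Icc, show Function.leftLim F o = F o from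
      hc.continuousWithinAt.leftLim_eq]
  have hfin : IsFiniteMeasure F.measure := ⟨by rw [huniv, hFm]; exact ENNReal.ofReal_lt_top⟩
  have hval : ∀ t, (a • x.stieltjes i) (Icc o t) = F.measure.toSignedMeasure (Icc o t) := by
    intro t
    rw [Measure.toSignedMeasure_apply_measurable measurableSet_Icc, measureReal_def, hFm,
      ENNReal.toReal_ofReal (sub_nonneg.2 (hx (ho t))), _root_.smul_apply,
      stieltjes_Icc x i (ho t), smul_eq_mul, mul_sub]
  -- both sides are determined by their values on initial segments
  have heq : a • x.stieltjes i = F.measure.toSignedMeasure := by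
    refine VectorMeasure.ext_of_generateFrom (range Iic) ?_
      (BorelSpace.measurable_eq.trans (borel_eq_generateFrom_Iic _)) isPiSystem_Iic ?_
    · rintro _ ⟨t, rfl⟩
      rw [hIic, hval]
    · rw [huniv, hval]
  by_cases hB : MeasurableSet B
  · have := congrArg (fun m : SignedMeasure (Icc (0 : ℝ) T) => m B) heq
    simp only [_root_.smul_apply, smul_eq_mul] at this
    rw [this, Measure.toSignedMeasure_apply_measurable hB]
    exact measureReal_nonneg
  · rw [VectorMeasure.not_measurable _ hB, mul_zero]

/-- For paths with equal signatures, the increments of the coordinate `i` carry `dx^j` and `dy^j` to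
the same signed measure on `ℝ`. -/
theorem stieltjes_preimage_eq (hT : 0 ≤ T) (hxy : signature x = signature y) (i j : Fin d)
    {A : Set ℝ} (hA : MeasurableSet A) :
    x.stieltjes j (incr hT x i ⁻¹' A) = y.stieltjes j (incr hT y i ⁻¹' A) := by
  refine signedMeasure_preimage_eq_of_moments (continuous_incr x hT i) (continuous_incr y hT i)
    (fun k => ?_) hA
  rw [integral_incr_pow x hT, integral_incr_pow y hT, coeff, coeff, hxy]

/-- The monotone coordinate of one path is monotone, in the same direction, for every path with the
same signature, even if the latter is only known to be monotone in another coordinate `j`. Weak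
monotonicity of `y^i` holds because `a dy^i` along the injective `y^j` has the same law as the
positive measure `a dx^i` along `x^j`; strictness because `dy^j` along `y^i` has the same law as
`dx^j` along the injective `x^i`, which has no atoms. -/
theorem strictMono_of_signature_eq (hT : 0 ≤ T) (hxy : signature x = signature y) {i j : Fin d}
    {a b : ℝ} (hx : StrictMono fun t => a * x.toFun t i)
    (hy : StrictMono fun t => b * y.toFun t j) : StrictMono fun t => a * y.toFun t i := by
  have hmono : Monotone fun t => a * y.toFun t i := by
    intro s t hst
    have hA : MeasurableSet {r : ℝ | b * r ∈ Icc (b * incr hT y j s) (b * incr hT y j t)} :=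
      (measurable_const_mul b) measurableSet_Icc
    have hpre : incr hT y j ⁻¹' {r : ℝ | b * r ∈ Icc (b * incr hT y j s) (b * incr hT y j t)} =
        Icc s t := by
      ext r
      simp only [incr, mem_preimage, mem_ofPred_eq, mem_Icc, mul_sub, sub_le_sub_iff_right]
      exact and_congr hy.le_iff_le hy.le_iff_le
    have h1 := stieltjes_preimage_eq hT hxy j i hA
    have h2 := mul_stieltjes_nonneg hT hx.monotone (incr hT x j ⁻¹'
      {r : ℝ | b * r ∈ Icc (b * incr hT y j s) (b * incr hT y j t)})
    rw [h1, hpre, stieltjes_Icc y i hst, mul_sub] at h2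
    exact sub_nonneg.1 h2
  refine hmono.strictMono_of_injective fun s t hst => ?_
  by_contra hne
  wlog hlt : s < t generalizing s t
  · exact this t s hst.symm (Ne.symm hne) (lt_of_le_of_ne (not_lt.1 hlt) (Ne.symm hne))
  -- the level set of `y^i` through `s` and `t` is a nontrivial interval, an atom of `dy^j`
  -- along `y^i`
  set A : Set ℝ := {r | a * r = a * incr hT y i s}
  have hA : MeasurableSet A := (measurable_const_mul a) (measurableSet_singleton _)
  have hmem : ∀ r, r ∈ incr hT y i ⁻¹' A ↔ a * y.toFun r i = a * y.toFun s i := by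
    intro r
    simp only [A, incr, mem_preimage, mem_ofPred_eq, mul_sub, sub_left_inj]
  have hclosed : IsClosed (incr hT y i ⁻¹' A) :=
    (isClosed_singleton.preimage (continuous_const_mul a)).preimage (continuous_incr y hT i)
  obtain ⟨m, hm, hm'⟩ := hclosed.isCompact.exists_isLeast ⟨s, (hmem s).2 rfl⟩
  obtain ⟨M, hM, hM'⟩ := hclosed.isCompact.exists_isGreatest ⟨s, (hmem s).2 rfl⟩
  have hms : m ≤ s := hm' ((hmem s).2 rfl)
  have htM : t ≤ M := hM' ((hmem t).2 hst.symm)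
  have hpre : incr hT y i ⁻¹' A = Icc m M := by
    ext r
    refine ⟨fun hr => ⟨hm' hr, hM' hr⟩, fun hr => (hmem r).2 (le_antisymm ?_ ?_)⟩
    · exact (hmono hr.2).trans_eq ((hmem M).1 hM)
    · exact ((hmem m).1 hm).symm.trans_le (hmono hr.1)
  have hsub : (incr hT x i ⁻¹' A).Subsingleton := by
    intro r hr r' hr'
    refine hx.injective ?_
    have : a * incr hT x i r = a * incr hT x i r' := Eq.trans hr (Eq.symm hr')
    simpa [incr, mul_sub] using this
  have h0 : x.stieltjes j (incr hT x i ⁻¹' A) = 0 := by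
    rcases hsub.eq_empty_or_singleton with h | ⟨r, h⟩
    · rw [h, VectorMeasure.empty]
    · rw [h, stieltjes_singleton]
  rw [stieltjes_preimage_eq hT hxy i j hA, hpre,
    stieltjes_Icc y j (hms.trans (hlt.le.trans htM)), sub_eq_zero] at h0
  exact (hy (hms.trans_lt (hlt.trans_le htM))).ne (by simp only [h0])

/-- Paths with equal signatures which are strictly monotone in a common coordinate agree up to
translation after both are parametrised by that coordinate. -/
theorem sameUnparam_of_strictMono (hT : 0 ≤ T) (hxy : signature x = signature y) {i : Fin d}
    {a : ℝ} (hx : StrictMono fun t => a * x.toFun t i)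
    (hy : StrictMono fun t => a * y.toFun t i) : x.SameUnparam y := by
  set o : Icc (0 : ℝ) T := ⟨0, left_mem_Icc.2 hT⟩
  set e : Icc (0 : ℝ) T := ⟨T, right_mem_Icc.2 hT⟩
  have ho : ∀ s : Icc (0 : ℝ) T, o ≤ s := fun s => s.2.1
  have he : ∀ s : Icc (0 : ℝ) T, s ≤ e := fun s => s.2.2
  have hmono : ∀ {z : MonotonePath T d}, StrictMono (fun t => a * z.toFun t i) →
      StrictMono fun t => a * incr hT z i t := by
    intro z hz s t hst
    simp only [incr, mul_sub]
    exact sub_lt_sub_right (hz hst) _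
  have hpc : PreconnectedSpace (Icc (0 : ℝ) T) := Subtype.preconnectedSpace isPreconnected_Icc
  have hrange : ∀ {z : MonotonePath T d}, StrictMono (fun t => a * z.toFun t i) →
      range (fun t => a * incr hT z i t) = Icc 0 (a * z.stieltjes i univ) := by
    intro z hz
    have huniv : (univ : Set (Icc (0 : ℝ) T)) = Icc o e := univ_eq_Icc hT
    have h0 : a * incr hT z i o = 0 := by simp [incr, o]
    have h1 : a * incr hT z i e = a * z.stieltjes i univ := by
      rw [huniv, stieltjes_Icc z i (ho e)]; rfl
    have h2 : range (fun t => a * incr hT z i t) =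
        Icc (a * incr hT z i o) (a * incr hT z i e) := by
      refine Subset.antisymm ?_
        (intermediate_value_univ o e (continuous_const.mul (continuous_incr z hT i)))
      rintro _ ⟨t, rfl⟩
      exact ⟨(hmono hz).monotone (ho t), (hmono hz).monotone (he t)⟩
    rwa [h0, h1] at h2
  have hr : range (fun t => a * incr hT y i t) = range (fun t => a * incr hT x i t) := by
    rw [hrange hx, hrange hy]
    have := stieltjes_preimage_eq hT hxy i i MeasurableSet.univ
    simp only [preimage_univ] at this
    rw [this]
  -- `φ` sends `t` to the time at which `x^i` has the increment of `y^i` at `t`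
  let φ : Icc (0 : ℝ) T ≃o Icc (0 : ℝ) T :=
    ((StrictMono.orderIso _ (hmono hy)).trans (OrderIso.setCongr _ _ hr)).trans
      (StrictMono.orderIso _ (hmono hx)).symm
  have hφ : ∀ t, a * incr hT x i (φ t) = a * incr hT y i t := fun t =>
    congrArg Subtype.val ((StrictMono.orderIso _ (hmono hx)).apply_symm_apply
      (OrderIso.setCongr _ _ hr (StrictMono.orderIso _ (hmono hy) t)))
  have hIic : ∀ t, Iic t = Icc o t := Iic_eq_Icc_left hT
  have key : ∀ t m, y.toFun t m - y.toFun o m = x.toFun (φ t) m - x.toFun o m := by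
    intro t m
    have hA : MeasurableSet {r : ℝ | a * r ≤ a * incr hT y i t} :=
      (measurable_const_mul a) measurableSet_Iic
    have h := stieltjes_preimage_eq hT hxy i m hA
    have hy' : incr hT y i ⁻¹' {r : ℝ | a * r ≤ a * incr hT y i t} = Icc o t := by
      rw [← hIic]
      ext s
      exact (hmono hy).le_iff_le
    have hx' : incr hT x i ⁻¹' {r : ℝ | a * r ≤ a * incr hT y i t} = Icc o (φ t) := by
      rw [← hIic]
      ext s
      rw [← hφ]
      exact (hmono hx).le_iff_le
    rw [hy', hx', stieltjes_Icc y m (ho t), stieltjes_Icc x m (ho _)] at h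
    exact h.symm
  refine ⟨φ, y.toFun o - x.toFun o, fun t => ?_⟩
  funext m
  have := key t m
  simp only [Pi.add_apply, Pi.sub_apply]
  linarith

theorem exists_strictMono_mul (x : MonotonePath T d) :
    ∃ (i : Fin d) (a : ℝ), StrictMono fun t => a * x.toFun t i := by
  obtain ⟨i, h | h⟩ := x.exists_monotone
  · exact ⟨i, 1, by simpa using h⟩
  · exact ⟨i, -1, fun s t hst => by simpa using h hst⟩

/-- The signature determines a path with a monotone coordinate up to translation and
reparametrisation. -/
theorem sameUnparam_of_signature_eq (hT : 0 ≤ T) (hxy : signature x = signature y) :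
    x.SameUnparam y := by
  obtain ⟨i, a, hx⟩ := exists_strictMono_mul x
  obtain ⟨j, b, hy⟩ := exists_strictMono_mul y
  exact sameUnparam_of_strictMono hT hxy hx (strictMono_of_signature_eq hT hxy hx hy)

end Injectivity

/-! ### The signature as an element of a Hilbert space -/

section Tensor

variable {d : ℕ}

/-- The action `B ⊗ ... ⊗ B` of a matrix on tensors of level `k`, in coordinates. -/
def tensorMap (B : Matrix (Fin d) (Fin d) ℝ) (k : ℕ) (a : (Fin k → Fin d) → ℝ)
    (M : Fin k → Fin d) : ℝ :=
  ∑ I, a I * ∏ l, B (M l) (I l)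

theorem prod_mul_apply (A B : Matrix (Fin d) (Fin d) ℝ) {k : ℕ} (I J : Fin k → Fin d) :
    ∏ l, (A * B) (I l) (J l) = ∑ M : Fin k → Fin d, ∏ l, (A (I l) (M l) * B (M l) (J l)) := by
  simp only [Matrix.mul_apply, Finset.prod_univ_sum, Fintype.piFinset_univ]

theorem levelInner_transpose_mul (B : Matrix (Fin d) (Fin d) ℝ) (k : ℕ)
    (a b : (Fin k → Fin d) → ℝ) :
    levelInner (B.transpose * B) k a b = ∑ M, tensorMap B k a M * tensorMap B k b M := by
  simp only [levelInner, tensorMap, prod_mul_apply, Finset.prod_mul_distrib,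
    Matrix.transpose_apply]
  simp only [Finset.sum_mul_sum]
  conv_rhs => rw [Finset.sum_comm]
  refine Finset.sum_congr rfl fun I _ => ?_
  conv_rhs => rw [Finset.sum_comm]
  refine Finset.sum_congr rfl fun J _ => ?_
  rw [Finset.mul_sum]
  refine Finset.sum_congr rfl fun M _ => ?_
  ring

theorem tensorMap_tensorMap (A B : Matrix (Fin d) (Fin d) ℝ) (k : ℕ) (a : (Fin k → Fin d) → ℝ) :
    tensorMap A k (tensorMap B k a) = tensorMap (A * B) k a := by
  funext N
  simp only [tensorMap, prod_mul_apply, Finset.sum_mul, Finset.mul_sum, Finset.prod_mul_distrib]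
  rw [Finset.sum_comm]
  refine Finset.sum_congr rfl fun I _ => Finset.sum_congr rfl fun M _ => ?_
  ring

theorem tensorMap_one (k : ℕ) (a : (Fin k → Fin d) → ℝ) : tensorMap 1 k a = a := by
  funext M
  rw [tensorMap, Finset.sum_eq_single M]
  · simp
  · intro I _ hI
    obtain ⟨l, hl⟩ := Function.ne_iff.1 hI
    rw [Finset.prod_eq_zero (f := fun l => (1 : Matrix (Fin d) (Fin d) ℝ) (M l) (I l))
      (Finset.mem_univ l) (Matrix.one_apply_ne hl.symm), mul_zero]
  · simp

theorem tensorMap_sub (B : Matrix (Fin d) (Fin d) ℝ) (k : ℕ) (a b : (Fin k → Fin d) → ℝ) :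
    tensorMap B k (a - b) = tensorMap B k a - tensorMap B k b := by
  funext M
  simp only [tensorMap, Pi.sub_apply, sub_mul, Finset.sum_sub_distrib]

/-- Square-summable families indexed by all multi-indices. -/
abbrev TensorSpace (d : ℕ) : Type := lp (fun _ : Σ k, (Fin k → Fin d) => ℝ) 2

/-- If the coordinates of `f, g` in the Hilbert space are those of `a, b` in an orthonormal basis for
`G = Bᵀ B`, the inner products agree. -/
theorem tensorInner_eq_inner (B : Matrix (Fin d) (Fin d) ℝ) {a b : TensorSeries d}
    {f g : TensorSpace d} (hf : ∀ k M, f ⟨k, M⟩ = tensorMap B k (a k) M)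
    (hg : ∀ k M, g ⟨k, M⟩ = tensorMap B k (b k) M) :
    Summable (fun k => levelInner (B.transpose * B) k (a k) (b k)) ∧
      tensorInner (B.transpose * B) a b = ⟪f, g⟫_ℝ := by
  have h := lp.hasSum_inner (𝕜 := ℝ) f g
  have h2 := h.sigma fun k => hasSum_fintype _
  have e : (fun k => ∑ M, ⟪f ⟨k, M⟩, g ⟨k, M⟩⟫_ℝ) =
      fun k => levelInner (B.transpose * B) k (a k) (b k) := by
    funext k
    rw [levelInner_transpose_mul]
    refine Finset.sum_congr rfl fun M _ => ?_
    rw [hf, hg, real_inner_eq_re_inner, RCLike.inner_apply]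
    simp [mul_comm]
  rw [e] at h2
  exact ⟨h2.summable, h2.tsum_eq⟩

end Tensor

section Feature

variable {T : ℝ} {d : ℕ}

/-- Square summability: level `k` has `d ^ k` entries, each of which is `O(C ^ k / k!)`. -/
theorem memℓp_tensorMap_signature (hT : 0 ≤ T) (B : Matrix (Fin d) (Fin d) ℝ)
    (x : MonotonePath T d) :
    Memℓp (fun p : Σ k, (Fin k → Fin d) => tensorMap B p.1 (signature x p.1) p.2) 2 := by
  rw [memℓp_gen_iff (by norm_num)]
  simp only [ENNReal.toReal_ofNat, Real.rpow_ofNat]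
  set A : ℝ := ∫ s, ∑ i, |density x i s| ∂(refMeasure x)
  have hA : 0 ≤ A := integral_nonneg fun s => Finset.sum_nonneg fun i _ => abs_nonneg _
  set β : ℝ := ∑ i, ∑ j, |B i j|
  have hβ : ∀ i j, |B i j| ≤ β := fun i j =>
    (Finset.single_le_sum (f := fun j => |B i j|) (fun _ _ => abs_nonneg _)
      (Finset.mem_univ j)).trans
    (Finset.single_le_sum (f := fun i => ∑ j, |B i j|)
      (fun _ _ => Finset.sum_nonneg fun _ _ => abs_nonneg _) (Finset.mem_univ i))
  have hβ0 : 0 ≤ β := Finset.sum_nonneg fun _ _ => Finset.sum_nonneg fun _ _ => abs_nonneg _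
  have hbound : ∀ k M, |tensorMap B k (signature x k) M| ≤ (d * A * β) ^ k / k.factorial := by
    intro k M
    calc |tensorMap B k (signature x k) M|
        ≤ ∑ I : Fin k → Fin d, |signature x k I * ∏ l, B (M l) (I l)| :=
          Finset.abs_sum_le_sum_abs _ _
      _ ≤ ∑ I : Fin k → Fin d, A ^ k / k.factorial * β ^ k := by
          refine Finset.sum_le_sum fun I _ => ?_
          rw [abs_mul, Finset.abs_prod]
          refine mul_le_mul (abs_signature_le x hT k I) ?_
            (Finset.prod_nonneg fun _ _ => abs_nonneg _) (by positivity)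
          refine (Finset.prod_le_prod (fun _ _ => abs_nonneg _) fun l _ => hβ _ _).trans_eq ?_
          simp
      _ = (d * A * β) ^ k / k.factorial := by
          simp [mul_pow]
          ring
  rw [summable_sigma_of_nonneg fun _ => sq_nonneg _]
  refine ⟨fun k => (hasSum_fintype _).summable, ?_⟩
  refine Summable.of_nonneg_of_le (fun k => tsum_nonneg fun _ => sq_nonneg _) (fun k => ?_)
    (Real.summable_pow_div_factorial (d * (d * A * β) ^ 2))
  rw [tsum_fintype]
  have hfac : (1 : ℝ) ≤ k.factorial := by exact_mod_cast k.factorial_pos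
  calc ∑ M : Fin k → Fin d, ‖tensorMap B k (signature x k) M‖ ^ 2
      ≤ ∑ M : Fin k → Fin d, ((d * A * β) ^ k / k.factorial) ^ 2 :=
        Finset.sum_le_sum fun M _ => pow_le_pow_left₀ (norm_nonneg _) (hbound k M) 2
    _ = (d * (d * A * β) ^ 2) ^ k / k.factorial / k.factorial := by
        simp [mul_pow, div_pow]
        ring
    _ ≤ (d * (d * A * β) ^ 2) ^ k / k.factorial :=
        div_le_self (by positivity) hfac

/-- The signature in orthonormal coordinates for `G = Bᵀ B`, as an element of a Hilbert space. -/
noncomputable def feature (hT : 0 ≤ T) (B : Matrix (Fin d) (Fin d) ℝ) (x : MonotonePath T d) :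
    TensorSpace d :=
  ⟨_, memℓp_tensorMap_signature hT B x⟩

theorem feature_apply (hT : 0 ≤ T) (B : Matrix (Fin d) (Fin d) ℝ) (x : MonotonePath T d) (k : ℕ)
    (M : Fin k → Fin d) : feature hT B x ⟨k, M⟩ = tensorMap B k (signature x k) M := rfl

theorem sigKernel_eq_inner (hT : 0 ≤ T) (B : Matrix (Fin d) (Fin d) ℝ) (x y : MonotonePath T d) :
    sigKernel (B.transpose * B) x y = ⟪feature hT B x, feature hT B y⟫_ℝ :=
  (tensorInner_eq_inner B (feature_apply hT B x) (feature_apply hT B y)).2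

theorem continuous_feature (hT : 0 ≤ T) (B : Matrix (Fin d) (Fin d) ℝ)
    [TopologicalSpace (MonotonePath T d)]
    (hS : SignatureContinuous (T := T) (B.transpose * B)) :
    Continuous (feature (T := T) hT B) := by
  rw [continuous_iff_continuousAt]
  intro x
  have h : (fun y => tensorInner (B.transpose * B) (signature y - signature x)
      (signature y - signature x)) = fun y => ‖feature hT B y - feature hT B x‖ ^ 2 := by
    funext y
    have hc : ∀ k M, (feature hT B y - feature hT B x) ⟨k, M⟩ =
        tensorMap B k ((signature y - signature x) k) M := by
      intro k M
      rw [lp.coeFn_sub, Pi.sub_apply, feature_apply, feature_apply, Pi.sub_apply, tensorMap_sub,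
        Pi.sub_apply]
    rw [(tensorInner_eq_inner B hc hc).2, real_inner_self_eq_norm_sq]
  have hx := hS x
  rw [h] at hx
  rw [ContinuousAt, tendsto_iff_norm_sub_tendsto_zero]
  have := (Real.continuous_sqrt.tendsto 0).comp hx
  simpa [Function.comp_def, Real.sqrt_sq] using this

/-- Signature coefficients are continuous linear functionals of the feature. -/
theorem exists_coeff_eq_inner (hT : 0 ≤ T) {B : Matrix (Fin d) (Fin d) ℝ} (hB : IsUnit B)
    (w : List (Fin d)) : ∃ v : TensorSpace d, ∀ x : MonotonePath T d,
      coeff w x = ⟪v, feature hT B x⟫_ℝ := by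
  classical
  let I : Fin w.length → Fin d := fun l => w.get l.rev
  refine ⟨∑ M, (∏ l, B⁻¹ (I l) (M l)) •
    lp.single 2 (⟨w.length, M⟩ : Σ k, (Fin k → Fin d)) (1 : ℝ), fun x => ?_⟩
  have hinv : tensorMap B⁻¹ w.length (tensorMap B w.length (signature x w.length)) =
      signature x w.length := by
    rw [tensorMap_tensorMap, Matrix.nonsing_inv_mul B ((Matrix.isUnit_iff_isUnit_det B).1 hB),
      tensorMap_one]
  have : coeff w x = signature x w.length I := rfl
  rw [this, ← hinv, sum_inner, tensorMap]
  refine Finset.sum_congr rfl fun M _ => ?_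
  rw [real_inner_smul_left, lp.inner_single_left, feature_apply]
  simp [mul_comm]

theorem signature_eq_of_coeff_eq (hT : 0 ≤ T) {x y : MonotonePath T d}
    (h : ∀ w, coeff w x = coeff w y) : signature x = signature y := by
  funext k I
  rw [signature_eq_coeff x hT, signature_eq_coeff y hT, h]

theorem exists_transpose_mul_self_of_posDef {G : Matrix (Fin d) (Fin d) ℝ}
    (hG : G.PosDef) : ∃ B : Matrix (Fin d) (Fin d) ℝ, IsUnit B ∧ G = B.transpose * B := by
  open scoped MatrixOrder in
  obtain ⟨B, hB⟩ := CStarAlgebra.nonneg_iff_eq_star_mul_self.mp hG.posSemidef.nonneg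
  have hB' : G = B.transpose * B := by
    rw [hB, Matrix.star_eq_conjTranspose, Matrix.conjTranspose_eq_transpose_of_trivial]
  refine ⟨B, ?_, hB'⟩
  have hu := hG.isUnit
  rw [hB', Matrix.isUnit_iff_isUnit_det, Matrix.det_mul] at hu
  rw [Matrix.isUnit_iff_isUnit_det]
  exact isUnit_of_mul_isUnit_right hu

end Feature

/-! ### Mean embeddings of measures on a compact set -/

section KernelScore

variable {X H : Type*} [TopologicalSpace X] [MeasurableSpace X] [BorelSpace X]
  [NormedAddCommGroup H] {Φ : X → H} {K : Set X}

/-- A continuous feature map is Bochner integrable on a compact set: compactness of its range makes it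
strongly measurable although `H` need not be separable. -/
theorem integrable_feature (hΦ : Continuous Φ) (hK : IsCompact K) (P : Measure K)
    [IsFiniteMeasure P] : Integrable (fun z : K => Φ z) P := by
  have hc : Continuous fun z : K => Φ z := hΦ.comp continuous_subtype_val
  have : CompactSpace K := isCompact_iff_compactSpace.1 hK
  obtain ⟨C, hC⟩ := isCompact_univ.exists_bound_of_continuousOn hc.continuousOn
  exact Integrable.of_bound (hc.stronglyMeasurable_of_support_subset_isCompact isCompact_univ
    (subset_univ _)).aestronglyMeasurable C (Eventually.of_forall fun z => hC z trivial)

variable [InnerProductSpace ℝ H] [CompleteSpace H]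

/-- The set `K` need not be measurable in `X`, so a measure on `K` is treated as such and transported
by the inclusion only for measurable integrands. -/
theorem integrable_map_inner (hΦ : Continuous Φ) (hK : IsCompact K) (P : Measure K)
    [IsFiniteMeasure P] (v : H) :
    Integrable (fun x => ⟪v, Φ x⟫_ℝ) (P.map Subtype.val) ∧
      ∫ x, ⟪v, Φ x⟫_ℝ ∂(P.map Subtype.val) = ⟪v, ∫ z : K, Φ z ∂P⟫_ℝ := by
  have hc : Continuous fun x => ⟪v, Φ x⟫_ℝ := continuous_const.inner hΦ
  have hi := integrable_feature hΦ hK P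
  refine ⟨?_, ?_⟩
  · rw [integrable_map_measure hc.measurable.aestronglyMeasurable
      measurable_subtype_coe.aemeasurable]
    exact hi.const_inner v
  · rw [integral_map measurable_subtype_coe.aemeasurable hc.measurable.aestronglyMeasurable,
      integral_inner hi]

/-- The mean of the kernel over independent pairs is the squared norm of the mean feature. -/
theorem integrable_map_prod_inner (hΦ : Continuous Φ) (hK : IsCompact K) (P : Measure K)
    [IsFiniteMeasure P] (hm : Measurable fun z : X × X => ⟪Φ z.1, Φ z.2⟫_ℝ) :
    Integrable (fun z : X × X => ⟪Φ z.1, Φ z.2⟫_ℝ)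
      ((P.map Subtype.val).prod (P.map Subtype.val)) ∧
      ∫ z, ⟪Φ z.1, Φ z.2⟫_ℝ ∂((P.map Subtype.val).prod (P.map Subtype.val)) =
        ‖∫ z : K, Φ z ∂P‖ ^ 2 := by
  have hv : Measurable (Prod.map (Subtype.val : K → X) (Subtype.val : K → X)) :=
    measurable_subtype_coe.prodMap measurable_subtype_coe
  have hi := integrable_feature hΦ hK P
  have hint : Integrable (fun z : K × K => ⟪Φ z.1, Φ z.2⟫_ℝ) (P.prod P) := by
    obtain ⟨C, hC⟩ := hK.exists_bound_of_continuousOn hΦ.continuousOn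
    refine Integrable.of_bound (hm.comp hv).aestronglyMeasurable (C * C)
      (Eventually.of_forall fun z => ?_)
    exact (norm_inner_le_norm _ _).trans (mul_le_mul (hC _ z.1.2) (hC _ z.2.2) (norm_nonneg _)
      ((norm_nonneg _).trans (hC _ z.1.2)))
  rw [Measure.map_prod_map _ _ measurable_subtype_coe measurable_subtype_coe]
  refine ⟨?_, ?_⟩
  · rw [integrable_map_measure hm.aestronglyMeasurable hv.aemeasurable]
    exact hint
  · rw [integral_map hv.aemeasurable hm.aestronglyMeasurable]
    simp only [Prod.map_fst, Prod.map_snd]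
    rw [integral_prod _ hint]
    simp only [integral_inner hi]
    rw [← real_inner_self_eq_norm_sq, ← integral_inner hi]
    simp only [real_inner_comm]

end KernelScore

/-! ### Strict properness -/

variable {T : ℝ} {d : ℕ} [TopologicalSpace (MonotonePath T d)] {B : Matrix (Fin d) (Fin d) ℝ}

theorem continuous_coeff (hT : 0 ≤ T) (hB : IsUnit B)
    (hS : SignatureContinuous (T := T) (B.transpose * B)) (w : List (Fin d)) :
    Continuous (coeff (T := T) w) := by
  obtain ⟨v, hv⟩ := exists_coeff_eq_inner (T := T) hT hB w
  rw [funext hv]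
  exact continuous_const.inner (continuous_feature hT B hS)

variable [MeasurableSpace (MonotonePath T d)] [BorelSpace (MonotonePath T d)]

/-- Joint measurability for the product `σ`-algebra. Path space need not be second countable, so this
does not follow from continuity; the kernel is a countable sum of products of signature entries. -/
theorem measurable_inner_feature (hT : 0 ≤ T) (hB : IsUnit B)
    (hS : SignatureContinuous (T := T) (B.transpose * B)) :
    Measurable fun z : MonotonePath T d × MonotonePath T d =>
      ⟪feature hT B z.1, feature hT B z.2⟫_ℝ := by
  have h : ∀ k I, Measurable fun x : MonotonePath T d => signature x k I := fun k I => by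
    simp only [signature_eq_coeff _ hT]
    exact (continuous_coeff hT hB hS _).measurable
  simp only [← sigKernel_eq_inner]
  refine Measurable.tsum fun k => ?_
  unfold levelInner
  exact Finset.measurable_fun_sum _ fun I _ => Finset.measurable_fun_sum _ fun J _ =>
    (((h k I).comp measurable_fst).mul ((h k J).comp measurable_snd)).mul_const _

/-- The mean feature determines a finite measure on `K`: by the shuffle identity, expectations of the
coefficients are expectations of an algebra of functions, which separates the points of `K` up to
inseparability by uniqueness of signatures. -/
theorem eq_of_integral_feature_eq (hT : 0 ≤ T) (hB : IsUnit B)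
    (hS : SignatureContinuous (T := T) (B.transpose * B))
    {K : Set (MonotonePath T d)} (hK : IsCompact K)
    (hKid : ∀ x ∈ K, ∀ y ∈ K, x.SameUnparam y → Inseparable x y)
    {P Q : Measure K} [IsFiniteMeasure P] [IsFiniteMeasure Q]
    (h : ∫ z : K, feature hT B z ∂P = ∫ z : K, feature hT B z ∂Q) : P = Q := by
  have : CompactSpace K := isCompact_iff_compactSpace.1 hK
  refine ext_of_integral_family (fun (w : List (Fin d)) (z : K) => coeff w z.1)
    (fun w => (continuous_coeff hT hB hS w).comp continuous_subtype_val) (fun z z' hz => ?_)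
    ⟨[], fun z => rfl⟩ (fun w v => ⟨shuffles w v, fun z => coeff_mul_coeff z.1 hT w v⟩)
    (fun w => ?_)
  · have := hKid z z.2 z' z'.2 (sameUnparam_of_signature_eq hT (signature_eq_of_coeff_eq hT hz))
    exact (subtype_inseparable_iff _ _).2 this
  · obtain ⟨v, hv⟩ := exists_coeff_eq_inner (T := T) hT hB w
    have hΦ := continuous_feature hT B hS
    simp only [hv]
    rw [integral_inner (integrable_feature hΦ hK P), integral_inner (integrable_feature hΦ hK Q), h]

end SignatureKernel

open SignatureKernel in
theorem proposition2 {T : ℝ} (hT : 0 < T) {d : ℕ}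
    (G : Matrix (Fin d) (Fin d) ℝ) (hG : G.PosDef)
    [TopologicalSpace (MonotonePath T d)] [MeasurableSpace (MonotonePath T d)]
    [BorelSpace (MonotonePath T d)]
    (hS : SignatureContinuous (T := T) G)
    (K : Set (MonotonePath T d)) (hK : IsCompact K)
    (hKid : ∀ x ∈ K, ∀ y ∈ K, x.SameUnparam y → Inseparable x y) :
    -- the kernel, the score and the expected scores are well defined
    (∀ x y : MonotonePath T d,
      Summable (fun k => levelInner G k (signature x k) (signature y k))) ∧
    (∀ P ∈ probabilityMeasuresOn K,
      Integrable (fun z : MonotonePath T d × MonotonePath T d => sigKernel G z.1 z.2) (P.prod P) ∧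
      (∀ y : MonotonePath T d, Integrable (fun x => sigKernel G x y) P) ∧
      ∀ Q ∈ probabilityMeasuresOn K, Integrable (sigScore G P) Q) ∧
    -- strict properness
    IsStrictlyProper (sigScore G) (probabilityMeasuresOn K) := by
  obtain ⟨B, hB, rfl⟩ := exists_transpose_mul_self_of_posDef hG
  have hT' := hT.le
  have hΦ := continuous_feature hT' B hS
  have hm := measurable_inner_feature hT' hB hS
  have hscore : ∀ (P : Measure K) [IsProbabilityMeasure P],
      sigScore (B.transpose * B) (P.map Subtype.val) = fun y =>
        ‖∫ z : K, feature hT' B z ∂P‖ ^ 2 -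
          2 * ⟪∫ z : K, feature hT' B z ∂P, feature hT' B y⟫_ℝ := by
    intro P _
    funext y
    simp only [sigScore, sigKernel_eq_inner hT']
    rw [(integrable_map_prod_inner hΦ hK P hm).2]
    simp only [real_inner_comm (feature hT' B y)]
    rw [(integrable_map_inner hΦ hK P _).2]
  have hexp : ∀ (P Q : Measure K) [IsProbabilityMeasure P] [IsProbabilityMeasure Q],
      Integrable (sigScore (B.transpose * B) (P.map Subtype.val)) (Q.map Subtype.val) ∧
      ∫ y, sigScore (B.transpose * B) (P.map Subtype.val) y ∂(Q.map Subtype.val) =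
        ‖∫ z : K, feature hT' B z ∂P‖ ^ 2 -
          2 * ⟪∫ z : K, feature hT' B z ∂P, ∫ z : K, feature hT' B z ∂Q⟫_ℝ := by
    intro P Q _ _
    have : IsProbabilityMeasure (Q.map (Subtype.val : K → MonotonePath T d)) :=
      Measure.isProbabilityMeasure_map measurable_subtype_coe.aemeasurable
    obtain ⟨hi, he⟩ := integrable_map_inner hΦ hK Q (∫ z : K, feature hT' B z ∂P)
    rw [hscore]
    refine ⟨(integrable_const _).sub (hi.const_mul 2), ?_⟩
    rw [integral_sub (integrable_const _) (hi.const_mul 2), integral_const_mul, he]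
    simp
  refine ⟨fun x y => (tensorInner_eq_inner B (feature_apply hT' B x) (feature_apply hT' B y)).1,
    ?_, ?_⟩
  · rintro _ ⟨P, hP, rfl⟩
    refine ⟨?_, fun y => ?_, ?_⟩
    · simp only [sigKernel_eq_inner hT']
      exact (integrable_map_prod_inner hΦ hK P hm).1
    · simp only [sigKernel_eq_inner hT', real_inner_comm (feature hT' B y)]
      exact (integrable_map_inner hΦ hK P _).1
    · rintro _ ⟨Q, hQ, rfl⟩
      exact (hexp P Q).1
  · rintro _ ⟨P, hP, rfl⟩ _ ⟨Q, hQ, rfl⟩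
    have hdiff : ∫ y, sigScore (B.transpose * B) (P.map Subtype.val) y ∂(Q.map Subtype.val) -
        ∫ y, sigScore (B.transpose * B) (Q.map Subtype.val) y ∂(Q.map Subtype.val) =
        ‖∫ z : K, feature hT' B z ∂P - ∫ z : K, feature hT' B z ∂Q‖ ^ 2 := by
      rw [(hexp P Q).2, (hexp Q Q).2, norm_sub_sq_real, real_inner_self_eq_norm_sq]
      ring
    refine ⟨?_, fun h => ?_, fun h => by rw [h]⟩
    · have := sq_nonneg ‖∫ z : K, feature hT' B z ∂P - ∫ z : K, feature hT' B z ∂Q‖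
      linarith
    · rw [h, sub_self] at hdiff
      have hmean := sub_eq_zero.1 (norm_eq_zero.1 (pow_eq_zero_iff two_ne_zero |>.1 hdiff.symm))
      rw [eq_of_integral_feature_eq hT' hB hS hK hKid hmean]
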